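/- Let $q = R_1 \bowtie \cdots \bowtie R_k$ be a natural join query, where each relation $R_i$ has a finite set $\operatorname{attr}(R_i)$ of attributes, and let $D$ be a domain of values with at least two elements. An instance $I$ assigns to each relation $R_i$ a finite set $R_i(I)$ of tuples $\operatorname{attr}(R_i) \to D$. A subjoin $q'$ of $q$ is the natural join of some of the relations of $q$; $\operatorname{attr}(q')$ is the union of their attribute sets, and $q'(I)$ is the set of all tuples $\operatorname{attr}(q') \to D$ whose restriction to $\operatorname{attr}(R_i)$ lies in $R_i(I)$ for every relation $R_i$ of $q'$. The instance $I$ is fully reduced if $R_i(I) = \pi_{\operatorname{attr}(R_i)}(q(I))$ for every $i$, i.e. every tuple of every relation contributes to the output of $q$. The subjoin $q'$ is safe if $q'(I) = \pi_{\operatorname{attr}(q')}(q(I))$ for every fully reduced instance $I$. It involves no Cartesian product if it has at least one relation and the graph on its relations, in which two distinct relations are adjacent when they share an attribute, is connected. A $\gamma$-cycle of $q$ is a sequence $(S_1, x_1, S_2, x_2, \dots, S_m, x_m, S_{m+1})$ with $m \ge 3$, $S_{m+1} = S_1$, where $S_1, \dots, S_m$ are distinct relations of $q$, $x_1, \dots,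 x_m$ are distinct attributes, $x_i \in \operatorname{attr}(S_i) \cap \operatorname{attr}(S_{i+1})$ for $1 \le i \le m$, and, for $1 \le i < m$, $x_i$ belongs to no $S_j$ $(1\le j\le m)$ other than $S_i$ and $S_{i+1}$. The query $q$ is $\gamma$-acyclic if it has no $\gamma$-cycle. **Theorem.** Every subjoin of $q$ that involves no Cartesian product is safe if and only if $q$ is $\gamma$-acyclic. -/

import Mathlib

/-- A natural join query: its relations are indexed by `ι`, and `attr i` is the finite set of
attributes (the schema) of relation `i`. Distinct relations may have the same schema. -/
structure JoinQuery (ι α : Type*) where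
  /-- The attributes of each relation. -/
  attr : ι → Finset α

namespace JoinQuery

/-- A database instance of `q` over the value domain `D`: a finite set of tuples for each
relation, where a tuple over a set `X` of attributes is a function `X → D`. -/
structure Instance {ι α : Type*} (q : JoinQuery ι α) (D : Type*) where
  /-- The tuples of each relation. -/
  rel : ∀ i, Set (q.attr i → D)
  /-- Relations are finite. -/
  finite_rel : ∀ i, (rel i).Finite

section Output

variable {ι α : Type*} [DecidableEq α] (q : JoinQuery ι α)

/-- The attributes `attr(q')` of the subjoin `q'` of `q` made of the relations in `W`. -/
def attrs (W : Finset ι) : Finset α := W.biUnion q.attr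

theorem attr_subset_attrs {W : Finset ι} {i : ι} (hi : i ∈ W) : q.attr i ⊆ q.attrs W :=
  Finset.subset_biUnion_of_mem q.attr hi

theorem attrs_mono {V W : Finset ι} (h : V ⊆ W) : q.attrs V ⊆ q.attrs W :=
  Finset.biUnion_subset_biUnion_of_subset_left q.attr h

/-- The output `q'(I)` of the subjoin `q'` of `q` made of the relations in `W`: the tuples over
`attr(q')` whose restriction to the schema of each relation in `W` is a tuple of that relation. -/
def output {D : Type*} (I : q.Instance D) (W : Finset ι) : Set (q.attrs W → D) :=
  {t | ∀ (i : ι) (hi : i ∈ W),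
    Finset.restrict₂ (π := fun _ => D) (q.attr_subset_attrs hi) t ∈ I.rel i}

/-- The projection `π_Y(r)` of a set `r` of tuples over `X` onto a set `Y ⊆ X` of attributes. -/
def project {D : Type*} {X Y : Finset α} (h : Y ⊆ X) (r : Set (X → D)) : Set (Y → D) :=
  Finset.restrict₂ (π := fun _ => D) h '' r

/-- An instance is fully reduced if every tuple of every relation contributes to the output of
the full query, that is, each relation is the projection of that output onto its schema. -/
def FullyReduced [Fintype ι] {D : Type*} (I : q.Instance D) : Prop :=
  ∀ i, I.rel i =
    project (q.attr_subset_attrs (Finset.mem_univ i)) (q.output I Finset.univ)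

/-- The subjoin made of the relations in `W` is safe (over the value domain `D`): on every fully
reduced instance its output is the projection of the output of the full query. -/
def Safe [Fintype ι] (D : Type*) (W : Finset ι) : Prop :=
  ∀ I : q.Instance D, q.FullyReduced I →
    q.output I W = project (q.attrs_mono (Finset.subset_univ W)) (q.output I Finset.univ)

end Output

section Graph

variable {ι α : Type*} (q : JoinQuery ι α)

/-- The join graph of `q`: two distinct relations are adjacent if they share an attribute. -/
def joinGraph : SimpleGraph ι where
  Adj i j := i ≠ j ∧ ∃ a, a ∈ q.attr i ∧ a ∈ q.attr j
  symm := ⟨fun _ _ h => ⟨h.1.symm, h.2.imp fun _ ha => ⟨ha.2, ha.1⟩⟩⟩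
  loopless := ⟨fun _ h => h.1 rfl⟩

/-- The subjoin made of the relations in `W` involves no Cartesian product: `W` is non-empty and
the subgraph of the join graph that it induces is connected. -/
def NoCartesianProduct (W : Finset ι) : Prop :=
  (q.joinGraph.induce (W : Set ι)).Connected

/-- `(S 0, x 0, S 1, x 1, …, S (m-1), x (m-1), S 0)` with `m = n + 3` is a γ-cycle: the relations
`S i` are distinct, the attributes `x i` are distinct, `x i` is in the cyclically consecutive
relations `S i` and `S (i + 1)`, and, unless `i` is the last index, in no other relation of the
cycle. Addition in `Fin (n + 3)` is cyclic. -/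
structure IsGammaCycle {n : ℕ} (S : Fin (n + 3) → ι) (x : Fin (n + 3) → α) : Prop where
  injective_rel : Function.Injective S
  injective_attr : Function.Injective x
  mem_left : ∀ i, x i ∈ q.attr (S i)
  mem_right : ∀ i, x i ∈ q.attr (S (i + 1))
  pure : ∀ i, i ≠ Fin.last (n + 2) → ∀ j, x i ∈ q.attr (S j) → j = i ∨ j = i + 1

/-- `q` is γ-acyclic if it has no γ-cycle. -/
def GammaAcyclic : Prop :=
  ∀ (n : ℕ) (S : Fin (n + 3) → ι) (x : Fin (n + 3) → α), ¬ q.IsGammaCycle S x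

end Graph

end JoinQuery

/-! If `q` is γ-acyclic, then all that a relation `R` has in common with a connected set `W` lies in
a single `S` of `W` (`Grown.exists_absorbing`); otherwise a shortest path inside `W` would close up
to a γ-cycle. In a fully reduced instance, an assignment satisfying `W` agrees on `S` with some full
output tuple, whose values on `R` are therefore compatible with it, so `R` can join `W`. Repeating
this exhausts the component of `W`, and any output tuple serves for the remaining relations
(`Grown.exists_satisfies`).

Conversely, on a γ-cycle there is an instance, projected from two assignments, in which a value
propagates from `x 0` along the cycle to the last relation. The join of the two ends `S 0` and `S
(Fin.last (n + 2))` does not see this constraint, and is unsafe (`IsGammaCycle.exists_not_safe`). -/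

namespace JoinQuery

/-! ### Connected sets of relations in γ-acyclic queries -/

section Acyclic

variable {ι α : Type*} {q : JoinQuery ι α}

/-- Two relations share an attribute; a relation with an attribute shares it with itself. -/
def Share (q : JoinQuery ι α) (i j : ι) : Prop := ∃ a, a ∈ q.attr i ∧ a ∈ q.attr j

theorem Share.symm {i j : ι} (h : q.Share i j) : q.Share j i :=
  h.imp fun _ ha => ⟨ha.2, ha.1⟩

/-- Sets of relations obtained from a single relation by successively adding a relation that
shares an attribute with a previous one. -/
inductive Grown (q : JoinQuery ι α) : Set ι → Prop
  | singleton (i : ι) : Grown q {i}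
  | extend {W : Set ι} {i j : ι} : Grown q W → j ∈ W → q.Share i j → Grown q (insert i W)

theorem Grown.nonempty {W : Set ι} (h : q.Grown W) : W.Nonempty := by
  cases h with
  | singleton i => exact ⟨i, rfl⟩
  | extend _ _ _ => exact ⟨_, Set.mem_insert _ _⟩

/-- Along a chain the injectivity conditions of a γ-cycle follow from membership and purity. -/
theorem exists_isGammaCycle {n : ℕ} {S : ℕ → ι} {x : ℕ → α}
    (hl : ∀ i < n + 3, x i ∈ q.attr (S i))
    (hr : ∀ i < n + 2, x i ∈ q.attr (S (i + 1)))
    (h0 : x (n + 2) ∈ q.attr (S 0))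
    (hp : ∀ i < n + 2, ∀ j < n + 3, x i ∈ q.attr (S j) → j = i ∨ j = i + 1) :
    q.IsGammaCycle (n := n) (fun i => S i) (fun i => x i) := by
  have hval : ∀ i : Fin (n + 3), i ≠ Fin.last (n + 2) →
      (i : ℕ) < n + 2 ∧ ((i + 1 : Fin (n + 3)) : ℕ) = i + 1 := by
    intro i hi
    have hlt : (i : ℕ) < n + 2 := Fin.val_lt_last hi
    exact ⟨hlt, Fin.val_add_one_of_lt (Fin.lt_last_iff_ne_last.2 hi)⟩
  have hS : ∀ i j : ℕ, i < j → j < n + 3 → S i ≠ S j := by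
    intro i j hij hj h
    have h1 := hp i (by omega) j hj (h ▸ hl i (by omega))
    obtain rfl : j = i + 1 := by omega
    by_cases hi : i + 1 < n + 2
    · have := hp (i + 1) hi i (by omega) (h ▸ hl (i + 1) (by omega))
      omega
    -- Here `x (i + 1)` is the last attribute, which need not be pure; purity of `x n` separates the
    -- last two relations instead.
    · obtain rfl : i = n + 1 := by omega
      have := hp n (by omega) (n + 1 + 1) (by omega) (h ▸ hr n (by omega))
      omega
  have hx : ∀ i j : ℕ, i < j → j < n + 3 → x i ≠ x j := by
    intro i j hij hj h
    have h1 := hp i (by omega) j hj (h ▸ hl j hj)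
    obtain rfl : j = i + 1 := by omega
    by_cases hi : i + 1 < n + 2
    · have := hp i (by omega) (i + 2) (by omega) (h ▸ hr (i + 1) hi)
      omega
    · obtain rfl : i = n + 1 := by omega
      have := hp (n + 1) (by omega) 0 (by omega) (h ▸ h0)
      omega
  refine ⟨fun i j h => ?_, fun i j h => ?_, fun i => hl i i.2, fun i => ?_, fun i hi j h => ?_⟩
  · by_contra hne
    rcases lt_or_gt_of_ne (fun h' => hne (Fin.ext h') : (i : ℕ) ≠ j) with h' | h'
    · exact hS _ _ h' j.2 h
    · exact hS _ _ h' i.2 h.symm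
  · by_contra hne
    rcases lt_or_gt_of_ne (fun h' => hne (Fin.ext h') : (i : ℕ) ≠ j) with h' | h'
    · exact hx _ _ h' j.2 h
    · exact hx _ _ h' i.2 h.symm
  · by_cases hi : i = Fin.last (n + 2)
    · subst hi
      simpa using h0
    · rw [(hval i hi).2]
      exact hr i (hval i hi).1
  · have := hp i (hval i hi).1 j j.2 h
    rw [← (hval i hi).2] at this
    exact this.imp Fin.ext Fin.ext

/-- `v 0, …, v n` is a path in `W` from a relation that shares an attribute with `T` to one
that has an attribute in common with `R` that `T` lacks. -/
structure EscapePath (q : JoinQuery ι α) (W : Set ι) (R T : ι) (n : ℕ) (v : ℕ → ι) : Prop where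
  mem : ∀ i ≤ n, v i ∈ W
  start : q.Share T (v 0)
  step : ∀ i < n, q.Share (v i) (v (i + 1))
  finish : ∃ b ∈ q.attr R, b ∈ q.attr (v n) ∧ b ∉ q.attr T

/-- A shortest escape path closes up to a γ-cycle when some common attribute of `R` and `T` does
not occur on the path. -/
theorem EscapePath.not_gammaAcyclic {W : Set ι} {R T : ι} {n : ℕ} {v : ℕ → ι}
    (h : q.EscapePath W R T n v) (hmin : ∀ m < n, ∀ w, ¬ q.EscapePath W R T m w)
    {a : α} (haR : a ∈ q.attr R) (haT : a ∈ q.attr T) (haW : ∀ i ∈ W, a ∉ q.attr i) :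
    ¬ q.GammaAcyclic := by
  -- Minimality, in three forms: dropping a prefix, truncating at an earlier exit, and cutting along
  -- a chord would each give a shorter escape path.
  have hstart : ∀ j ≤ n, q.Share T (v j) → j = 0 := by
    intro j hj hs
    by_contra h0
    refine hmin (n - j) (by omega) (fun i => v (j + i)) ⟨fun i hi => h.mem _ (by omega), hs,
      fun i hi => h.step (j + i) (by omega), ?_⟩
    have := h.finish
    rwa [← Nat.add_sub_of_le hj] at this
  have hfin : ∀ j < n, ∀ b ∈ q.attr R, b ∈ q.attr (v j) → b ∈ q.attr T := by
    intro j hj b hbR hbj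
    by_contra hbT
    exact hmin j hj v ⟨fun i hi => h.mem i (by omega), h.start,
      fun i hi => h.step i (by omega), b, hbR, hbj, hbT⟩
  have hmid : ∀ i j, i < j → j ≤ n → q.Share (v i) (v j) → j = i + 1 := by
    intro i j hij hj hs
    by_contra hne
    refine hmin (n - (j - i - 1)) (by omega)
      (fun k => if k ≤ i then v k else v (k + (j - i - 1)))
      ⟨fun k hk => ?_, by simpa using h.start, fun k hk => ?_, ?_⟩
    · split_ifs
      · exact h.mem _ (by omega)
      · exact h.mem _ (by omega)
    · rcases lt_trichotomy k i with hki | rfl | hki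
      · rw [if_pos hki.le, if_pos (show k + 1 ≤ i from hki)]
        exact h.step k (by omega)
      · rw [if_pos le_rfl, if_neg (by omega), show k + 1 + (j - k - 1) = j by omega]
        exact hs
      · rw [if_neg (by omega), if_neg (by omega),
          show k + 1 + (j - i - 1) = k + (j - i - 1) + 1 by omega]
        exact h.step _ (by omega)
    · rw [if_neg (by omega), show n - (j - i - 1) + (j - i - 1) = n by omega]
      exact h.finish
  obtain ⟨b, hbR, hbn, hbT⟩ := h.finish
  obtain ⟨c, hcT, hc0⟩ := h.start
  have hy : ∀ i, ∃ y, i < n → y ∈ q.attr (v i) ∧ y ∈ q.attr (v (i + 1)) := by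
    intro i
    by_cases hi : i < n
    · exact (h.step i hi).imp fun _ hy _ => hy
    · exact ⟨a, fun h' => absurd h' hi⟩
  choose y hy using hy
  have hyT : ∀ i < n, y i ∉ q.attr T := fun i hi hT =>
    absurd (hstart (i + 1) hi ⟨_, hT, (hy i hi).2⟩) (by omega)
  have hyR : ∀ i < n, y i ∉ q.attr R := fun i hi hR =>
    hyT i hi (hfin i hi _ hR (hy i hi).1)
  -- The cycle is `v 0, …, v n, R, T` with links `y i`, `b`, `a`, `c`. Only `c` can be impure, since
  -- it may lie in `R`, so it takes the exempt last place.
  let S : ℕ → ι := fun i => if i ≤ n then v i else if i = n + 1 then R else T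
  let x : ℕ → α := fun i => if i < n then y i else if i = n then b else if i = n + 1 then a else c
  have S1 : ∀ i ≤ n, S i = v i := fun i hi => if_pos hi
  have S2 : S (n + 1) = R := by simp [S]
  have S3 : S (n + 2) = T := by simp [S]
  have x1 : ∀ i < n, x i = y i := fun i hi => if_pos hi
  have x2 : x n = b := by simp [x]
  have x3 : x (n + 1) = a := by simp [x]
  have x4 : x (n + 2) = c := by simp [x]
  have hcases : ∀ i < n + 3, i < n ∨ i = n ∨ i = n + 1 ∨ i = n + 2 := by omega
  intro hq
  refine hq n _ _ (exists_isGammaCycle (S := S) (x := x) (fun i hi => ?_) (fun i hi => ?_) ?_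
    fun i hi j hj hij => ?_)
  · rcases hcases i hi with hi | rfl | rfl | rfl
    · rw [x1 i hi, S1 i hi.le]
      exact (hy i hi).1
    · rwa [x2, S1 _ le_rfl]
    · rwa [x3, S2]
    · rwa [x4, S3]
  · rcases hcases i (by omega) with hi | rfl | rfl | rfl
    · rw [x1 i hi, S1 _ hi]
      exact (hy i hi).2
    · rwa [x2, S2]
    · rwa [x3, S3]
    · omega
  · rwa [x4, S1 0 (Nat.zero_le _)]
  · rcases hcases i (by omega) with hi | rfl | rfl | rfl
    · rw [x1 i hi] at hij
      rcases (by omega : j ≤ n ∨ j = n + 1 ∨ j = n + 2) with hj | rfl | rfl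
      · rw [S1 j hj] at hij
        rcases lt_trichotomy i j with hlt | rfl | hlt
        · exact Or.inr (hmid i j hlt hj ⟨_, (hy i hi).1, hij⟩)
        · exact Or.inl rfl
        · have := hmid j (i + 1) (by omega) (by omega) ⟨_, hij, (hy i hi).2⟩
          omega
      · exact absurd (S2 ▸ hij) (hyR i hi)
      · exact absurd (S3 ▸ hij) (hyT i hi)
    · rw [x2] at hij
      rcases (by omega : j < i ∨ j = i ∨ j = i + 1 ∨ j = i + 2) with hj | hj | hj | rfl
      · rw [S1 j hj.le] at hij
        exact absurd (hfin j hj b hbR hij) hbT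
      · exact Or.inl hj
      · exact Or.inr hj
      · exact absurd (S3 ▸ hij) hbT
    · rw [x3] at hij
      rcases (by omega : j ≤ n ∨ j = n + 1 ∨ j = n + 2) with hj | hj | hj
      · rw [S1 j hj] at hij
        exact absurd hij (haW _ (h.mem j hj))
      · exact Or.inl hj
      · exact Or.inr hj
    · omega

theorem Grown.reflTransGen {W : Set ι} (h : q.Grown W) :
    ∀ i ∈ W, ∀ j ∈ W, Relation.ReflTransGen (fun i j => i ∈ W ∧ j ∈ W ∧ q.Share i j) i j := by
  induction h with
  | singleton k =>
    rintro i rfl j rfl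
    exact .refl
  | @extend W k l _ hl hs ih =>
    have hmono : ∀ i ∈ W, ∀ j ∈ W, Relation.ReflTransGen
        (fun i j => i ∈ insert k W ∧ j ∈ insert k W ∧ q.Share i j) i j :=
      fun i hi j hj => Relation.ReflTransGen.mono
        (fun _ _ h => ⟨.inr h.1, .inr h.2.1, h.2.2⟩) _ _ (ih i hi j hj)
    rintro i (rfl | hi) j (rfl | hj)
    · exact .refl
    · exact .head ⟨.inl rfl, .inr hl, hs⟩ (hmono l hl j hj)
    · exact .tail (hmono i hi l hl) ⟨.inr hl, .inl rfl, hs.symm⟩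
    · exact hmono i hi j hj

theorem exists_escapePath {W : Set ι} {R T i j : ι} (hj : j ∈ W)
    (hij : Relation.ReflTransGen (fun i j => i ∈ W ∧ j ∈ W ∧ q.Share i j) i j)
    (hT : q.Share T i) (hb : ∃ b ∈ q.attr R, b ∈ q.attr j ∧ b ∉ q.attr T) :
    ∃ n v, q.EscapePath W R T n v := by
  have : ∃ (n : ℕ) (v : ℕ → ι), v 0 = i ∧ v n = j ∧ (∀ k ≤ n, v k ∈ W) ∧
      ∀ k < n, q.Share (v k) (v (k + 1)) := by
    clear hT
    induction hij using Relation.ReflTransGen.head_induction_on with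
    | refl => exact ⟨0, fun _ => j, rfl, rfl, fun _ _ => hj, fun _ h => absurd h (by omega)⟩
    | @head i k hik _ ih =>
      obtain ⟨n, v, h0, hn, hm, hs⟩ := ih
      refine ⟨n + 1, fun m => Nat.casesOn m i v, rfl, hn, ?_, ?_⟩
      · rintro (_ | m) hm'
        · exact hik.1
        · exact hm m (by omega)
      · rintro (_ | m) hm'
        · subst h0
          exact hik.2.2
        · exact hs m (by omega)
  obtain ⟨n, v, h0, hn, hm, hs⟩ := this
  exact ⟨n, v, hm, h0 ▸ hT, hs, hn ▸ hb⟩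

/-- In a γ-acyclic query, what a relation has in common with a connected set of relations it has
in common with one of them. -/
theorem Grown.exists_absorbing (hq : q.GammaAcyclic) {W : Set ι} (h : q.Grown W) (R : ι) :
    ∃ S ∈ W, ∀ a ∈ q.attr R, ∀ i ∈ W, a ∈ q.attr i → a ∈ q.attr S := by
  induction h with
  | singleton k => exact ⟨k, rfl, by rintro a - i rfl h; exact h⟩
  | @extend W T l hW hl hs ih =>
    obtain ⟨S, hS, hSW⟩ := ih
    by_cases h1 : ∀ a ∈ q.attr R, a ∈ q.attr T → a ∈ q.attr S
    · refine ⟨S, .inr hS, ?_⟩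
      rintro a haR i (rfl | hi) ha
      · exact h1 a haR ha
      · exact hSW a haR i hi ha
    by_cases h2 : ∀ b ∈ q.attr R, b ∈ q.attr S → b ∈ q.attr T
    · refine ⟨T, .inl rfl, ?_⟩
      rintro a haR i (rfl | hi) ha
      · exact ha
      · exact h2 a haR (hSW a haR i hi ha)
    -- Neither `S` nor `T` absorbs: `R` meets `T` outside `S`, and `S` outside `T`. As `S` absorbs
    -- for `W`, the attribute `a` occurs nowhere in `W`.
    push Not at h1 h2
    obtain ⟨a, haR, haT, haS⟩ := h1
    have hex := exists_escapePath hS (hW.reflTransGen l hl S hS) hs h2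
    classical
    obtain ⟨v, hv⟩ := Nat.find_spec hex
    exact absurd hq (hv.not_gammaAcyclic (fun m hm w hw => Nat.find_min hex hm ⟨w, hw⟩) haR haT
      fun i hi hai => haS (hSW a haR i hi hai))

/-- A maximal grown subset of `W` is all of `W`: otherwise a walk leaving it crosses its boundary
along an edge, which allows one more extension. -/
theorem NoCartesianProduct.grown {W : Finset ι} (h : q.NoCartesianProduct W) :
    q.Grown (W : Set ι) := by
  classical
  obtain ⟨⟨i, hi⟩⟩ := h.nonempty
  obtain ⟨C, hC⟩ := (W.powerset.filter fun C : Finset ι => q.Grown (C : Set ι)).exists_maximal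
    ⟨{i}, by simpa using ⟨hi, Grown.singleton i⟩⟩
  obtain ⟨hCW, hCg⟩ : C ⊆ W ∧ q.Grown (C : Set ι) := by simpa using hC.prop
  obtain rfl | hne := eq_or_ne C W
  · exact hCg
  exfalso
  obtain ⟨j, hj, hjC⟩ := Finset.exists_of_ssubset (hCW.ssubset_of_ne hne)
  obtain ⟨k, hk⟩ := hCg.nonempty
  obtain ⟨p⟩ := h.preconnected ⟨k, hCW hk⟩ ⟨j, hj⟩
  obtain ⟨d, -, hd1, hd2⟩ := p.exists_boundary_dart {i | (i : ι) ∈ C} hk hjC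
  have hadj : q.Share (d.fst : ι) d.snd := (SimpleGraph.induce_adj.1 d.adj).2
  have hmem : insert (d.snd : ι) C ∈ W.powerset.filter fun C : Finset ι => q.Grown (C : Set ι) := by
    simp only [Finset.mem_filter, Finset.mem_powerset, Finset.coe_insert]
    exact ⟨Finset.insert_subset d.snd.2 hCW, hCg.extend hd1 hadj.symm⟩
  exact hd2 (hC.le_of_ge hmem (Finset.subset_insert _ _) (Finset.mem_insert_self _ _))

end Acyclic

/-! ### Extending partial solutions to the full join -/

section Extension

variable {ι α D : Type*} {q : JoinQuery ι α}

/-- The assignment `f` of values to all attributes satisfies the relation `i`. -/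
def Satisfies (I : q.Instance D) (f : α → D) (i : ι) : Prop := (fun a : q.attr i => f a) ∈ I.rel i

theorem satisfies_congr {I : q.Instance D} {f g : α → D} {i : ι}
    (h : ∀ a ∈ q.attr i, f a = g a) : Satisfies I f i ↔ Satisfies I g i := by
  have : (fun a : q.attr i => f a) = fun a : q.attr i => g a := funext fun a => h a a.2
  rw [Satisfies, Satisfies, this]

variable [DecidableEq α]

/-- A value assignment that extends a given tuple. -/
theorem exists_extension [Nonempty D] {X : Finset α} (t : X → D) :
    ∃ f : α → D, (fun a : X => f a) = t := by
  refine ⟨fun a => if h : a ∈ X then t ⟨a, h⟩ else Classical.arbitrary D, funext fun a => ?_⟩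
  simp

theorem mem_output_iff {I : q.Instance D} {W : Finset ι} {f : α → D} :
    (fun a : q.attrs W => f a) ∈ q.output I W ↔ ∀ i ∈ W, Satisfies I f i :=
  Iff.rfl

theorem FullyReduced.exists_satisfies [Fintype ι] [Nonempty D] {I : q.Instance D}
    (hI : q.FullyReduced I) {f : α → D} {i : ι} (h : Satisfies I f i) :
    ∃ g : α → D, (∀ j, Satisfies I g j) ∧ ∀ a ∈ q.attr i, g a = f a := by
  rw [Satisfies, hI i] at h
  obtain ⟨u, hu, hui⟩ := h
  obtain ⟨g, rfl⟩ := exists_extension u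
  exact ⟨g, fun j => mem_output_iff.1 hu j (Finset.mem_univ j),
    fun a ha => congrFun hui ⟨a, ha⟩⟩

/-- Induction on the number of relations outside `W`. Overwriting `f` on `R` by an output tuple `u`
that agrees with `f` on the absorbing `S` changes nothing on `W`. -/
theorem Grown.exists_satisfies [Fintype ι] [Nonempty D] (hq : q.GammaAcyclic) {I : q.Instance D}
    (hI : q.FullyReduced I) {W : Finset ι} (hW : q.Grown (W : Set ι)) {f : α → D}
    (hf : ∀ i ∈ W, Satisfies I f i) :
    ∃ g : α → D, (∀ j, Satisfies I g j) ∧ ∀ i ∈ W, ∀ a ∈ q.attr i, g a = f a := by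
  classical
  induction hn : Wᶜ.card using Nat.strong_induction_on generalizing W f with
  | _ n ih =>
  subst hn
  by_cases hR : ∃ R, R ∉ W ∧ ∃ j ∈ W, q.Share R j
  · obtain ⟨R, hRW, j, hj, hs⟩ := hR
    obtain ⟨S, hS, hSW⟩ := hW.exists_absorbing hq R
    obtain ⟨u, hu, huS⟩ := hI.exists_satisfies (hf S hS)
    have hfg : ∀ i ∈ W, ∀ a ∈ q.attr i, (if a ∈ q.attr R then u a else f a) = f a := by
      intro i hi a ha
      split_ifs with haR
      · exact huS a (hSW a haR i hi ha)
      · rfl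
    obtain ⟨g, hg, hgW⟩ := ih (insert R W)ᶜ.card
      (Finset.card_lt_card (Finset.compl_ssubset_compl.2 (Finset.ssubset_insert hRW)))
      (W := insert R W) (by rw [Finset.coe_insert]; exact hW.extend hj hs)
      (f := fun a => if a ∈ q.attr R then u a else f a)
      (by
        intro i hi
        rcases Finset.mem_insert.1 hi with rfl | hi
        · exact (satisfies_congr fun a ha => if_pos ha).2 (hu i)
        · exact (satisfies_congr (hfg i hi)).2 (hf i hi)) rfl
    exact ⟨g, hg, fun i hi a ha =>
      (hgW i (Finset.mem_insert_of_mem hi) a ha).trans (hfg i hi a ha)⟩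
  · push Not at hR
    obtain ⟨k, hk⟩ := hW.nonempty
    obtain ⟨u, hu, -⟩ := hI.exists_satisfies (hf k hk)
    have hg : ∀ i ∈ W, ∀ a ∈ q.attr i, (if a ∈ q.attrs W then f a else u a) = f a :=
      fun i hi a ha => if_pos (q.attr_subset_attrs hi ha)
    -- No relation outside `W` shares an attribute with `W`, so an arbitrary output tuple `u` can be
    -- used there.
    refine ⟨fun a => if a ∈ q.attrs W then f a else u a, fun i => ?_, hg⟩
    by_cases hi : i ∈ W
    · exact (satisfies_congr (hg i hi)).2 (hf i hi)
    · refine (satisfies_congr fun a ha => if_neg fun haW => ?_).2 (hu i)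
      obtain ⟨j, hj, haj⟩ := Finset.mem_biUnion.1 haW
      exact hR i hi j hj ⟨a, ha, haj⟩

theorem GammaAcyclic.safe [Fintype ι] [Nonempty D] (hq : q.GammaAcyclic) {W : Finset ι}
    (hW : q.NoCartesianProduct W) : q.Safe D W := by
  intro I hI
  ext t
  constructor
  · intro ht
    obtain ⟨f, rfl⟩ := exists_extension t
    obtain ⟨g, hg, hgf⟩ := hW.grown.exists_satisfies hq hI (mem_output_iff.1 ht)
    refine ⟨fun a => g a, mem_output_iff.2 fun i _ => hg i, funext fun a => ?_⟩
    obtain ⟨i, hi, ha⟩ := Finset.mem_biUnion.1 a.2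
    exact hgf i hi a ha
  · rintro ⟨u, hu, rfl⟩
    exact fun i _ => hu i (Finset.mem_univ i)

/-! ### Unsafe subjoins from γ-cycles -/

/-- The instance formed by the projections of finitely many value assignments. -/
def instanceOf (q : JoinQuery ι α) (A : Set (α → D)) (hA : A.Finite) : q.Instance D where
  rel i := (fun (f : α → D) (a : q.attr i) => f a) '' A
  finite_rel _ := hA.image _

theorem fullyReduced_instanceOf [Fintype ι] {A : Set (α → D)} (hA : A.Finite) :
    q.FullyReduced (q.instanceOf A hA) := by
  intro i
  ext t
  constructor
  · rintro ⟨f, hf, rfl⟩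
    exact ⟨fun a => f a, fun j _ => ⟨f, hf, rfl⟩, rfl⟩
  · rintro ⟨u, hu, rfl⟩
    exact hu i (Finset.mem_univ i)

theorem IsGammaCycle.exists_not_safe [Fintype ι] [Nontrivial D] {n : ℕ} {S : Fin (n + 3) → ι}
    {x : Fin (n + 3) → α} (h : q.IsGammaCycle S x) :
    ∃ W : Finset ι, q.NoCartesianProduct W ∧ ¬ q.Safe D W := by
  classical
  obtain ⟨d₀, d₁, hd⟩ := exists_pair_ne D
  have hne : Fin.last (n + 2) ≠ 0 := by simp [Fin.ext_iff]
  have hlast : x (Fin.last (n + 2)) ∈ q.attr (S 0) := by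
    simpa using h.mem_right (Fin.last (n + 2))
  have h0last : x 0 ∉ q.attr (S (Fin.last (n + 2))) := by
    intro h0
    rcases h.pure 0 hne.symm _ h0 with h' | h'
    · exact hne h'
    · simp [Fin.ext_iff] at h'
  refine ⟨{S 0, S (Fin.last (n + 2))}, ?_, fun hsafe => ?_⟩
  · rw [NoCartesianProduct, Finset.coe_pair]
    exact SimpleGraph.induce_pair_connected_of_adj
      ⟨fun h' => hne (h.injective_rel h').symm, _, hlast, h.mem_left _⟩
  -- The possibly impure last attribute gets `d₀` in `f`. So `t` looks like `f` on `S 0` and like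
  -- the constant `d₀` on the last relation.
  · let f : α → D := fun a => if ∃ i, i ≠ Fin.last (n + 2) ∧ a = x i then d₁ else d₀
    let t : α → D := fun a => if a = x 0 then d₁ else d₀
    have hA : ({fun _ => d₀, f} : Set (α → D)).Finite := Set.toFinite _
    have ht : (fun a : q.attrs {S 0, S (Fin.last (n + 2))} => t a) ∈
        q.output (q.instanceOf _ hA) {S 0, S (Fin.last (n + 2))} := by
      refine mem_output_iff.2 fun i hi => ?_
      rcases Finset.mem_insert.1 hi with rfl | hi
      · refine ⟨f, by simp, funext fun a => if_congr ⟨?_, fun ha => ⟨0, hne.symm, ha⟩⟩ rfl rfl⟩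
        rintro ⟨i, hi, ha⟩
        -- By purity, `x 0` is the only attribute in `S 0` to which `f` gives `d₁`.
        rcases h.pure i hi 0 (ha ▸ a.2) with h' | h'
        · rw [ha, h']
        · exact absurd (add_right_cancel ((h'.symm.trans (Fin.last_add_one _).symm))) hi
      · obtain rfl := Finset.mem_singleton.1 hi
        refine ⟨fun _ => d₀, by simp, funext fun a => (if_neg fun ha => ?_).symm⟩
        exact h0last (ha ▸ a.2)
    rw [hsafe _ (fullyReduced_instanceOf hA)] at ht
    obtain ⟨u, hu, hut⟩ := ht
    have : Nonempty D := ⟨d₀⟩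
    obtain ⟨g, rfl⟩ := exists_extension u
    have hgt : ∀ i ∈ ({S 0, S (Fin.last (n + 2))} : Finset ι), ∀ a ∈ q.attr i, g a = t a :=
      fun i hi a ha => congrFun hut ⟨a, q.attr_subset_attrs hi ha⟩
    -- Both assignments are constant on the non-last `x i`, so each `S (i + 1)` up to index `n + 1`
    -- carries the value `d₁` from `x i` to `x (i + 1)`.
    have hg : ∀ i (hi : i < n + 2), g (x ⟨i, by omega⟩) = d₁ := by
      intro i
      induction i with
      | zero =>
        intro _
        exact (hgt (S 0) (by simp) _ (h.mem_left 0)).trans (if_pos rfl)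
      | succ i ih =>
        intro hi
        have hl := h.mem_left ⟨i + 1, by omega⟩
        have hr := h.mem_right ⟨i, by omega⟩
        rw [show (⟨i, by omega⟩ + 1 : Fin (n + 3)) = ⟨i + 1, by omega⟩ from Fin.ext
          (Fin.val_add_one_of_lt (Fin.lt_def.2 (by simp; omega)))] at hr
        obtain ⟨w, hw, hwg⟩ := mem_output_iff.1 hu (S ⟨i + 1, by omega⟩) (Finset.mem_univ _)
        have e₁ : w (x ⟨i, by omega⟩) = d₁ := (congrFun hwg ⟨_, hr⟩).trans (ih (by omega))
        refine (congrFun hwg ⟨_, hl⟩).symm.trans ?_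
        rcases hw with rfl | rfl
        · exact e₁
        · exact if_pos ⟨_, by simp [Fin.ext_iff]; omega, rfl⟩
    -- The attribute `x (n + 1)` also lies in the last relation, where `t` forces `d₀`.
    have hmem := h.mem_right ⟨n + 1, by omega⟩
    rw [show (⟨n + 1, by omega⟩ + 1 : Fin (n + 3)) = Fin.last (n + 2) from Fin.ext
      (Fin.val_add_one_of_lt (Fin.lt_def.2 (by simp)))] at hmem
    have h1 := hg (n + 1) (by omega)
    rw [hgt (S (Fin.last (n + 2))) (by simp) _ hmem] at h1
    exact hd ((if_neg fun h' => by simpa [Fin.ext_iff] using h.injective_attr h').symm.trans h1)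

end Extension

end JoinQuery

theorem theorem1 {ι α D : Type*} [Fintype ι] [DecidableEq α] [Nontrivial D]
    (q : JoinQuery ι α) :
    (∀ W : Finset ι, q.NoCartesianProduct W → q.Safe D W) ↔ q.GammaAcyclic := by
  refine ⟨fun h n S x hc => ?_, fun hq W hW => hq.safe hW⟩
  obtain ⟨W, hW, hns⟩ := hc.exists_not_safe (D := D)
  exact hns (h W hW)
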